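/- Let $\mathcal M$ be a locally compact Hausdorff space with a countable base. Let $(P_t)_{t\ge 0}$ be a Feller semigroup on $C_0(\mathcal M)$, i.e. a strongly continuous semigroup of positive contractions. Let $\phi:\mathbb R\to\mathbb R$ be a function. On a measurable space let $(\mathbb P^{(x,v)})_{(x,v)\in\mathcal M\times\mathbb R}$ be probability measures, $M=\{M(t)\}_{t\ge0}$ an $\mathcal M$-valued càdlàg process, and $\sigma=\{\sigma(t)\}_{t\ge0}$ a real-valued process with càdlàg nondecreasing paths. Put $\sigma_0(t)=\sigma(t)-\sigma(0)$. Assume that under each $\mathbb P^{(x,v)}$: - $M$ is a Feller process with semigroup $(P_t)$ started at $x$: $M(0)=x$ a.s., and $\mathbb E^{(x,v)}[f(M(s+t))\mid \sigma(M(r):r\le s)]=P_tf(M(s))$ a.s. for all $f\in C_0(\mathcal M)$ and $s,t\ge0$; - $\sigma(0)=v$ a.s., and $\sigma_0$ is a subordinator with Laplace exponent $\phi$: it has stationary independent increments and $\mathbb E^{(x,v)}[e^{-\lambda\sigma_0(t)}]=e^{-t\phi(\lambda)}$ for all $t\ge 0$, $\lambda>0$; - $M$ and $\sigma$ are independent.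 Let $M^\phi(t)=M(\sigma_0(t))$. Then the canonical process $((M^\phi,\sigma),\mathcal F,\mathcal F_t,P^{(x,v)})$ is a Markov additive process. Here the canonical process is the coordinate process on the space of càdlàg paths $[0,\infty)\to\mathcal M\times\mathbb R$, $\mathcal F$ is the $\sigma$-algebra generated by the coordinates, $(\mathcal F_t)$ is the natural filtration, and $P^{(x,v)}$ is the law of $(M^\phi,\sigma)$ under $\mathbb P^{(x,v)}$. That it is a Markov additive process means the following: 1. $(x,v)\mapsto P^{(x,v)}(\Lambda)$ is measurable for every $\Lambda\in\mathcal F$, the process is $(\mathcal F_t)$-adapted, $P^{(x,v)}(M^\phi(0)=x,\ \sigma(0)=v)=1$, and for all $s,t\ge0$ and measurable $C\subseteq\mathcal M\times\mathbb R$, $$P^{(x,v)}\big((M^\phi(s+t),\sigma(s+t))\in C\mid\mathcal F_s\big)=P^{(M^\phi(s),\sigma(s))}\big((M^\phi(t),\sigma(t))\in C\big)\quad\text{a.s.}$$ 2. The probability kernels $Q_t(x,C)=P^{(x,0)}\big((M^\phi(t),\sigma(t))\in C\big)$ form a semi-Markov transition function: $Q_0(x,\cdot)=\delta_{(x,0)}$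 and $Q_{s+t}(x,C)=\int Q_s(x,dy\times du)\,Q_t\big(y,\{(z,w):(z,u+w)\in C\}\big)$ for all $s,t\ge0$, $x\in\mathcal M$ and measurable $C$. 3. The conditional law of the future state of $M^\phi$ and the future increment of $\sigma$ depends only on the present state of $M^\phi$: for all $(x,v)$, $s,t\ge0$ and measurable $C\subseteq\mathcal M\times\mathbb R$, $$P^{(x,v)}\big((M^\phi(s+t),\sigma(s+t)-\sigma(s))\in C\mid\mathcal F_s\big)=Q_t(M^\phi(s),C)\quad\text{a.s.}$$ -/

import Mathlib

open MeasureTheory ProbabilityTheory Filter Topology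
open scoped NNReal ENNReal ZeroAtInfty

/-! ### Càdlàg paths -/

/-- A path `w : [0, ∞) → E` is càdlàg: right-continuous everywhere, with a left limit (in `E`) at
every time. At time `0` the filter `𝓝[<] 0` is trivial, so nothing is asked of the left limit. -/
def IsCadlag {E : Type*} [TopologicalSpace E] (w : ℝ≥0 → E) : Prop :=
  ∀ t, ContinuousWithinAt w (Set.Ici t) t ∧ ∃ l, Tendsto w (𝓝[<] t) (𝓝 l)

/-- The càdlàg path space `D([0, ∞), E)`. As a subtype of `ℝ≥0 → E` it carries the σ-algebra
generated by the coordinate maps. -/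
abbrev CadlagPath (E : Type*) [TopologicalSpace E] : Type _ := {w : ℝ≥0 → E // IsCadlag w}

theorem IsCadlag.prodMk {E F : Type*} [TopologicalSpace E] [TopologicalSpace F]
    {f : ℝ≥0 → E} {g : ℝ≥0 → F} (hf : IsCadlag f) (hg : IsCadlag g) :
    IsCadlag fun t => (f t, g t) := by
  intro t
  obtain ⟨a, ha⟩ := (hf t).2
  obtain ⟨b, hb⟩ := (hg t).2
  exact ⟨(hf t).1.prodMk (hg t).1, (a, b), ha.prodMk_nhds hb⟩

/-- A càdlàg path run along a nondecreasing right-continuous clock is càdlàg. -/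
theorem IsCadlag.comp_clock {E : Type*} [TopologicalSpace E] {f : ℝ≥0 → E} (hf : IsCadlag f)
    {τ : ℝ≥0 → ℝ≥0} (hm : Monotone τ) (hc : ∀ t, ContinuousWithinAt τ (Set.Ici t) t) :
    IsCadlag fun t => f (τ t) := by
  intro t
  refine ⟨(hf (τ t)).1.comp (hc t) fun s hs => hm hs, ?_⟩
  have hlub : Tendsto τ (𝓝[<] t) (𝓝 (sSup (τ '' Set.Iio t))) := hm.tendsto_nhdsLT t
  have hbdd : BddAbove (τ '' Set.Iio t) := by
    refine ⟨τ t, ?_⟩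
    rintro _ ⟨s, hs, rfl⟩
    exact hm (le_of_lt hs)
  by_cases h : ∃ s < t, τ s = sSup (τ '' Set.Iio t)
  · obtain ⟨s, hs, hse⟩ := h
    refine ⟨f (sSup (τ '' Set.Iio t)), ?_⟩
    refine (tendsto_congr' ?_).2 tendsto_const_nhds
    filter_upwards [Ioo_mem_nhdsLT hs] with u hu
    have h1 : τ u ≤ sSup (τ '' Set.Iio t) := le_csSup hbdd ⟨u, hu.2, rfl⟩
    have h2 : τ s ≤ τ u := hm (le_of_lt hu.1)
    rw [le_antisymm h1 (hse ▸ h2)]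
  · obtain ⟨l, hl⟩ := (hf (sSup (τ '' Set.Iio t))).2
    refine ⟨l, hl.comp (tendsto_nhdsWithin_iff.2 ⟨hlub, ?_⟩)⟩
    filter_upwards [self_mem_nhdsWithin] with u hu
    exact lt_of_le_of_ne (le_csSup hbdd ⟨u, hu, rfl⟩) fun he => h ⟨u, hu, he⟩

/-! ### Filtrations generated by a process -/

/-- The natural filtration `t ↦ σ(Z_r : r ≤ t)` of a process `Z`. -/
def naturalFiltration {Ω E : Type*} [mΩ : MeasurableSpace Ω] [mE : MeasurableSpace E]
    (Z : ℝ≥0 → Ω → E) (hZ : ∀ t, Measurable (Z t)) : Filtration ℝ≥0 mΩ where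
  seq t := ⨆ r ≤ t, mE.comap (Z r)
  mono' _ _ hst := biSup_mono fun _ hr => hr.trans hst
  le' _ := iSup₂_le fun r _ => (hZ r).comap_le

/-! ### Feller processes -/

/-- A Feller semigroup on `C₀(𝓜)`: a strongly continuous semigroup of positive contractions. -/
structure IsFellerSemigroup {𝓜 : Type*} [TopologicalSpace 𝓜]
    (S : ℝ≥0 → C₀(𝓜, ℝ) →L[ℝ] C₀(𝓜, ℝ)) : Prop where
  zero : ∀ f, S 0 f = f
  add : ∀ s t f, S (s + t) f = S s (S t f)
  nonneg : ∀ t f, (∀ x, 0 ≤ f x) → ∀ x, 0 ≤ S t f x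
  contraction : ∀ t f, ‖S t f‖ ≤ ‖f‖
  strongly_continuous : ∀ f, Tendsto (fun t => S t f) (𝓝 0) (𝓝 f)

/-- Under `μ`, the process `M` starts at `x` and is a (time-homogeneous) Markov process with
semigroup `S`, with respect to its natural filtration:
`E[f(M_{s+t}) | σ(M_r : r ≤ s)] = (S_t f)(M_s)` for `f ∈ C₀(𝓜)`. -/
structure IsMarkovWithSemigroup {𝓜 Ω : Type*} [TopologicalSpace 𝓜] [m𝓜 : MeasurableSpace 𝓜]
    [MeasurableSpace Ω] (S : ℝ≥0 → C₀(𝓜, ℝ) →L[ℝ] C₀(𝓜, ℝ))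
    (M : ℝ≥0 → Ω → 𝓜) (hM : ∀ t, Measurable (M t)) (x : 𝓜) (μ : Measure Ω) : Prop where
  initial : ∀ᵐ ω ∂μ, M 0 ω = x
  markov : ∀ (s t : ℝ≥0) (f : C₀(𝓜, ℝ)),
    μ[fun ω => f (M (s + t) ω) | naturalFiltration M hM s] =ᵐ[μ] fun ω => S t f (M s ω)

/-! ### Subordinators -/

/-- The distributional properties of a subordinator `Y` with Laplace exponent `φ` under `μ`:
stationary independent increments and `E[exp(-λ Y_t)] = exp(-t φ(λ))` for `λ > 0`. The path
properties (`Y_0 = 0`, nondecreasing, càdlàg) are imposed separately. -/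
structure HasSubordinatorLaw {Ω : Type*} [MeasurableSpace Ω] (φ : ℝ → ℝ)
    (Y : ℝ≥0 → Ω → ℝ) (μ : Measure Ω) : Prop where
  indep_increments : HasIndepIncrements Y μ
  stationary_increments : ∀ s t : ℝ≥0,
    IdentDistrib (fun ω => Y (s + t) ω - Y s ω) (fun ω => Y t ω - Y 0 ω) μ μ
  laplace : ∀ (t : ℝ≥0) (l : ℝ), 0 < l →
    ∫ ω, Real.exp (-(l * Y t ω)) ∂μ = Real.exp (-((t : ℝ) * φ l))

/-! ### Markov additive processes -/

/-- A (time-homogeneous) semi-Markov transition function `Q_t(x, dy × du)` from `E` to `E × ℝ`: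
`Q_0(x, ·) = δ_{(x, 0)}` and
`Q_{s+t}(x, C) = ∫ Q_s(x, dy × du) Q_t(y, {(z, w) : (z, u + w) ∈ C})`. -/
structure IsSemiMarkovTransition {E : Type*} [MeasurableSpace E]
    (Q : ℝ≥0 → Kernel E (E × ℝ)) : Prop where
  markov_kernel : ∀ t, IsMarkovKernel (Q t)
  zero : ∀ x, Q 0 x = Measure.dirac (x, 0)
  chapman_kolmogorov : ∀ (s t : ℝ≥0) (x : E) (C : Set (E × ℝ)), MeasurableSet C →
    Q (s + t) x C = ∫⁻ p, Q t p.1 {q | (q.1, p.2 + q.2) ∈ C} ∂(Q s x)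

/-- `((X, Y), F, (F_t), (P^{(x,v)}))` is a Markov additive process with semi-Markov transition
function `Q`: `(X, Y)` is a time-homogeneous Markov process with respect to `(F_t)`, started
at `(x, v)` under `P^{(x,v)}`, and the conditional law of the next state of `X` and of the
increment of `Y` given the past depends only on the present state of `X`:
`P^{(x,v)}(X_{s+t} ∈ A, Y_{s+t} - Y_s ∈ B | F_s) = Q_t(X_s, A × B)`, where
`Q_t(x, A × B) = P^{(x,0)}(X_t ∈ A, Y_t ∈ B)`. -/
structure IsMarkovAdditiveWith {Ω E : Type*} [mΩ : MeasurableSpace Ω] [MeasurableSpace E]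
    (ℱ : Filtration ℝ≥0 mΩ) (X : ℝ≥0 → Ω → E) (Y : ℝ≥0 → Ω → ℝ)
    (P : E × ℝ → Measure Ω) (Q : ℝ≥0 → Kernel E (E × ℝ)) : Prop where
  semiMarkov : IsSemiMarkovTransition Q
  isProbability : ∀ z, IsProbabilityMeasure (P z)
  measurable_law : ∀ B, MeasurableSet B → Measurable fun z => P z B
  adapted_fst : Adapted ℱ X
  adapted_snd : Adapted ℱ Y
  initial : ∀ z, ∀ᵐ ω ∂(P z), (X 0 ω, Y 0 ω) = z
  transition : ∀ (t : ℝ≥0) (x : E), Q t x = (P (x, 0)).map fun ω => (X t ω, Y t ω)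
  markov : ∀ (z : E × ℝ) (s t : ℝ≥0) (C : Set (E × ℝ)), MeasurableSet C →
    (P z)[Set.indicator {ω | (X (s + t) ω, Y (s + t) ω) ∈ C} (fun _ => (1 : ℝ)) | ℱ s]
      =ᵐ[P z] fun ω => (P (X s ω, Y s ω)).real {ω' | (X t ω', Y t ω') ∈ C}
  additive : ∀ (z : E × ℝ) (s t : ℝ≥0) (C : Set (E × ℝ)), MeasurableSet C →
    (P z)[Set.indicator {ω | (X (s + t) ω, Y (s + t) ω - Y s ω) ∈ C} (fun _ => (1 : ℝ)) | ℱ s]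
      =ᵐ[P z] fun ω => (Q t (X s ω)).real C

/-- `((X, Y), F, (F_t), (P^{(x,v)}))` is a Markov additive process. -/
def IsMarkovAdditive {Ω E : Type*} [mΩ : MeasurableSpace Ω] [MeasurableSpace E]
    (ℱ : Filtration ℝ≥0 mΩ) (X : ℝ≥0 → Ω → E) (Y : ℝ≥0 → Ω → ℝ)
    (P : E × ℝ → Measure Ω) : Prop :=
  ∃ Q : ℝ≥0 → Kernel E (E × ℝ), IsMarkovAdditiveWith ℱ X Y P Q

/-! ### The time-changed process and its canonical version -/

/-- `σ₀(t) = σ(t) - σ(0)`, as a nonnegative real (no truncation takes place when `σ` is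
nondecreasing in time). -/
noncomputable def clock {Ω : Type*} (σ : ℝ≥0 → Ω → ℝ) (t : ℝ≥0) (ω : Ω) : ℝ≥0 :=
  (σ t ω - σ 0 ω).toNNReal

/-- The path `t ↦ (M(σ₀(t)), σ(t))`. -/
noncomputable def pairPath {𝓜 Ω : Type*} [TopologicalSpace 𝓜]
    (M : ℝ≥0 → Ω → 𝓜) (σ : ℝ≥0 → Ω → ℝ)
    (hM : ∀ ω, IsCadlag fun t => M t ω) (hσ : ∀ ω, IsCadlag fun t => σ t ω)
    (hσm : ∀ ω, Monotone fun t => σ t ω) (ω : Ω) : CadlagPath (𝓜 × ℝ) :=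
  ⟨fun t => (M (clock σ t ω) ω, σ t ω),
    ((hM ω).comp_clock (τ := fun t => clock σ t ω)
      (fun _ _ h => Real.toNNReal_le_toNNReal (sub_le_sub_right (hσm ω h) _))
      (fun t => continuous_real_toNNReal.continuousAt.comp_continuousWithinAt
        ((hσ ω t).1.sub continuousWithinAt_const))).prodMk (hσ ω)⟩

/-- The canonical law: the law of the path of `(M(σ₀(·)), σ(·))` on the càdlàg path space, under
the measure `P^{(x,v)}`. -/
noncomputable def canonicalLaw {𝓜 Ω : Type*} [TopologicalSpace 𝓜] [MeasurableSpace 𝓜]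
    [MeasurableSpace Ω] (M : ℝ≥0 → Ω → 𝓜) (σ : ℝ≥0 → Ω → ℝ)
    (hM : ∀ ω, IsCadlag fun t => M t ω) (hσ : ∀ ω, IsCadlag fun t => σ t ω)
    (hσm : ∀ ω, Monotone fun t => σ t ω) (P : 𝓜 × ℝ → Measure Ω) (z : 𝓜 × ℝ) :
    Measure (CadlagPath (𝓜 × ℝ)) :=
  (P z).map (pairPath M σ hM hσ hσm)

/-- The natural filtration of the coordinate process on the càdlàg path space. -/
def canonicalFiltration (E : Type*) [TopologicalSpace E] [MeasurableSpace E] :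
    Filtration ℝ≥0 (inferInstance : MeasurableSpace (CadlagPath E)) :=
  naturalFiltration (fun t (w : CadlagPath E) => w.1 t)
    fun t => (measurable_pi_apply t).comp measurable_subtype_coe

/-! Everything rests on one disintegration: under each `P z`, the joint law of the past of the pair
up to `s` and of (state at `s + t`, increment of `σ` over `[s, s + t]`) is the law of the past
composed with a kernel that sees only the present state of the first component. That kernel draws a
duration `d` from the law of the increment of `σ` and runs the Feller process for time `d`. This is
`map_past_timeChangedPair`.

By independence the two processes can be frozen in turn. With `σ` frozen, the clock readings are
deterministic, and the ordinary Markov property of `M` at the time `clock σ s` replaces the next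
state by a kernel integral. With `M` frozen, what remains depends on the past of `σ` and on its next
increment, which are independent, so the increment can be averaged out. No strong Markov property
and no stopping time is needed.

The kernel must be the same for all starting points: `HasSubordinatorLaw.map_eq` gives this for the
increments by uniqueness of Laplace transforms, and the semigroup gives it for the transitions of
`M`, whose joint measurability in time and state comes from the Feller property.

On the path space, `isMarkovAdditiveWith_of_map_past` draws all the required properties from this
disintegration. Translating by the present value of the additive component yields the Markov
property of the pair; the case `s = 0` identifies the one-time laws, hence gives Chapman–Kolmogorov.
Measurability of the laws in the starting point is not assumed: it follows from the transition
kernels through finite-dimensional cylinders (`measurable_law_of_markov`). -/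

/-! ### Joint measurability of right-continuous processes -/

/-- Times in `[0, ∞)` can be approximated from the right along countably-valued measurable maps. -/
theorem exists_discretization_nnreal : ∃ (c : ℕ → ℕ → ℝ≥0) (k : ℕ → ℝ≥0 → ℕ),
    (∀ n, Measurable (k n)) ∧ ∀ t, Tendsto (fun n => c n (k n t)) atTop (𝓝[≥] t) := by
  -- The grid of mesh `1 / (n + 1)`, with `t` rounded to the grid point strictly above it; the `+ 1`
  -- in the numerator keeps the approximation on the right of `t`.
  refine ⟨fun n m => ((m : ℝ≥0) + 1) / ((n : ℝ≥0) + 1), fun n t => ⌊t * ((n : ℝ≥0) + 1)⌋₊,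
    fun n => Nat.measurable_floor.comp (measurable_id.mul_const _), fun t => ?_⟩
  have hle : ∀ n : ℕ, t ≤ ((⌊t * ((n : ℝ≥0) + 1)⌋₊ : ℝ≥0) + 1) / ((n : ℝ≥0) + 1) := fun n => by
    rw [le_div_iff₀ (by positivity)]
    exact (Nat.lt_floor_add_one _).le
  refine tendsto_nhdsWithin_iff.2 ⟨?_, Eventually.of_forall hle⟩
  refine tendsto_of_tendsto_of_tendsto_of_le_of_le (h := fun n : ℕ => t + 1 / ((n : ℝ≥0) + 1))
    tendsto_const_nhds ?_ hle fun n => ?_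
  · simpa using (tendsto_const_nhds (x := t)).add
      (tendsto_one_div_add_atTop_nhds_zero_nat (𝕜 := ℝ≥0))
  · have h1 : ((⌊t * ((n : ℝ≥0) + 1)⌋₊ : ℕ) : ℝ≥0) ≤ t * (n + 1) := Nat.floor_le zero_le
    have h2 : (0 : ℝ≥0) < (n : ℝ≥0) + 1 := by positivity
    change _ / _ ≤ _
    rw [div_le_iff₀ h2, add_mul, one_div, inv_mul_cancel₀ h2.ne']
    gcongr

/-- Sampling at the discretized times gives jointly measurable maps, since only countably many times
occur, and right continuity makes them converge pointwise. This is what makes evaluation at the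
random time `clock σ t` measurable. -/
theorem measurable_uncurry_of_rightContinuous {α E : Type*} [MeasurableSpace α]
    [TopologicalSpace E] [TopologicalSpace.PseudoMetrizableSpace E] [MeasurableSpace E]
    [BorelSpace E] {u : ℝ≥0 → α → E}
    (hu : ∀ a t, ContinuousWithinAt (fun r => u r a) (Set.Ici t) t)
    (h : ∀ t, Measurable (u t)) : Measurable fun p : ℝ≥0 × α => u p.1 p.2 := by
  obtain ⟨c, k, hk, hc⟩ := exists_discretization_nnreal
  refine measurable_of_tendsto_metrizable
    (f := fun n (p : ℝ≥0 × α) => u (c n (k n p.1)) p.2) (fun n => ?_)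
    (tendsto_pi_nhds.2 fun p => (hu p.2 p.1).tendsto.comp (hc p.1))
  have h1 : Measurable fun q : ℕ × α => u (c n q.1) q.2 :=
    measurable_from_prod_countable_right fun m => h (c n m)
  exact h1.comp (((hk n).comp measurable_fst).prodMk measurable_snd)

theorem measurable_cadlagPath_eval {E : Type*} [TopologicalSpace E]
    [TopologicalSpace.PseudoMetrizableSpace E] [MeasurableSpace E] [BorelSpace E] :
    Measurable fun p : ℝ≥0 × CadlagPath E => p.2.1 p.1 :=
  measurable_uncurry_of_rightContinuous (u := fun t (w : CadlagPath E) => w.1 t)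
    (fun w t => (w.2 t).1) fun t => (measurable_pi_apply t).comp measurable_subtype_coe

/-! ### Uniqueness of Laplace transforms -/

/-- The polynomials in `exp (-x)` form an algebra of bounded continuous functions separating points,
and their integrals involve the Laplace transform only at integers. -/
theorem measure_nnreal_ext_of_laplace {μ ν : Measure ℝ≥0} [IsProbabilityMeasure μ]
    [IsProbabilityMeasure ν]
    (h : ∀ l : ℝ, 0 < l → ∫ x, Real.exp (-(l * x)) ∂μ = ∫ x, Real.exp (-(l * x)) ∂ν) : μ = ν := by
  let e : BoundedContinuousFunction ℝ≥0 ℝ :=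
    BoundedContinuousFunction.ofNormedAddCommGroup (fun x : ℝ≥0 => Real.exp (-(x : ℝ)))
      (by fun_prop) 1 fun x => by
        rw [Real.norm_eq_abs, abs_of_pos (Real.exp_pos _), Real.exp_le_one_iff]
        simp
  have he : ∀ (n : ℕ) (x : ℝ≥0), e x ^ n = Real.exp (-(n * x)) := fun n x => by
    change Real.exp (-(x : ℝ)) ^ n = _
    rw [← Real.exp_nat_mul]
    congr 1
    ring
  let A : StarSubalgebra ℝ (BoundedContinuousFunction ℝ≥0 ℝ) :=
    { Algebra.adjoin ℝ {e} with
      star_mem' := fun {a} ha => by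
        have : star a = a := by ext x; simp
        rwa [this] }
  refine ext_of_forall_mem_subalgebra_integral_eq_of_polish (𝕜 := ℝ) (A := A) ?_ ?_
  · intro x y hxy
    refine ⟨e, ⟨BoundedContinuousFunction.toContinuousMap e, ⟨e, ?_, rfl⟩, rfl⟩, ?_⟩
    · exact Algebra.subset_adjoin (Set.mem_singleton e)
    · intro hh
      exact hxy (NNReal.coe_injective (neg_injective (Real.exp_injective hh)))
  · intro g hg
    have hg' : g ∈ Algebra.adjoin ℝ {e} := hg
    rw [Algebra.adjoin_singleton_eq_range_aeval] at hg'
    obtain ⟨p, rfl⟩ := hg'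
    have hp : ∀ x : ℝ≥0, (Polynomial.aeval e p : BoundedContinuousFunction ℝ≥0 ℝ) x
        = ∑ n ∈ Finset.range (p.natDegree + 1), p.coeff n * Real.exp (-(n * x)) := fun x => by
      rw [Polynomial.aeval_eq_sum_range, BoundedContinuousFunction.coe_sum, Finset.sum_apply]
      refine Finset.sum_congr rfl fun n _ => ?_
      rw [← he]
      simp
    have hi : ∀ (m : Measure ℝ≥0) [IsProbabilityMeasure m] (n : ℕ),
        Integrable (fun x : ℝ≥0 => p.coeff n * Real.exp (-(n * x))) m := fun m _ n => by
      refine ((Integrable.of_bound (C := 1) (by fun_prop) ?_).const_mul _)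
      refine Eventually.of_forall fun x => ?_
      rw [Real.norm_eq_abs, abs_of_pos (Real.exp_pos _), Real.exp_le_one_iff]
      have : (0 : ℝ) ≤ n * x := by positivity
      linarith
    change ∫ x, (Polynomial.aeval e p : BoundedContinuousFunction ℝ≥0 ℝ) x ∂μ
      = ∫ x, (Polynomial.aeval e p : BoundedContinuousFunction ℝ≥0 ℝ) x ∂ν
    simp only [hp]
    rw [integral_finsetSum _ fun n _ => hi μ n, integral_finsetSum _ fun n _ => hi ν n]
    refine Finset.sum_congr rfl fun n _ => ?_
    rw [integral_const_mul, integral_const_mul]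
    -- The hypothesis excludes `l = 0`; the constant term agrees because both measures have mass
    -- one.
    rcases Nat.eq_zero_or_pos n with rfl | hn
    · simp
    · rw [h n (by exact_mod_cast hn)]

/-! ### The past of a process -/

/-- The restriction of a path to `[0, s]`. -/
def pathPast {E : Type*} (s : ℝ≥0) (w : ℝ≥0 → E) : Set.Iic s → E := fun r => w r

theorem measurable_pathPast {Ω E : Type*} [MeasurableSpace Ω] [MeasurableSpace E]
    {Z : ℝ≥0 → Ω → E} (hZ : ∀ t, Measurable (Z t)) (s : ℝ≥0) :
    Measurable fun ω => pathPast s fun t => Z t ω :=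
  measurable_pi_lambda _ fun r => hZ r

/-- The terminal value of a path on `[0, s]`. -/
def presentState {E : Type*} (s : ℝ≥0) (u : Set.Iic s → E) : E := u ⟨s, Set.self_mem_Iic⟩

theorem measurable_presentState {E : Type*} [MeasurableSpace E] (s : ℝ≥0) :
    Measurable (presentState (E := E) s) :=
  measurable_pi_apply (X := fun _ => E) (⟨s, Set.self_mem_Iic⟩ : Set.Iic s)

/-- Conditioning on the past thereby becomes conditioning on a single random variable, so
conditional laws can be handled as disintegrations of joint laws. -/
theorem naturalFiltration_eq_comap {Ω E : Type*} [MeasurableSpace Ω] [MeasurableSpace E]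
    (Z : ℝ≥0 → Ω → E) (hZ : ∀ t, Measurable (Z t)) (s : ℝ≥0) :
    (naturalFiltration Z hZ s : MeasurableSpace Ω)
      = MeasurableSpace.comap (fun ω => pathPast s fun t => Z t ω) inferInstance := by
  change (⨆ r ≤ s, MeasurableSpace.comap (Z r) _) = _
  simp only [MeasurableSpace.pi, MeasurableSpace.comap_iSup, MeasurableSpace.comap_comp]
  rw [iSup_subtype']
  rfl

/-! ### Conditional laws -/

/-- Evaluating the disintegration on rectangles `B ×ˢ C` gives the defining integral identity of the
conditional expectation on the event `U ∈ B`. -/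
theorem condExp_indicator_of_map_eq_compProd {Ω A E : Type*} [mΩ : MeasurableSpace Ω]
    [mA : MeasurableSpace A] [MeasurableSpace E] {μ : Measure Ω} [IsProbabilityMeasure μ]
    {U : Ω → A} {X : Ω → E} (hU : Measurable U) (hX : Measurable X) {κ : Kernel A E}
    [IsMarkovKernel κ] (h : μ.map (fun ω => (U ω, X ω)) = μ.map U ⊗ₘ κ)
    {C : Set E} (hC : MeasurableSet C) :
    μ[Set.indicator {ω | X ω ∈ C} (fun _ => (1 : ℝ)) | mA.comap U]
      =ᵐ[μ] fun ω => (κ (U ω)).real C := by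
  have hCm : MeasurableSet {ω | X ω ∈ C} := hX hC
  have hκ : Measurable fun a => (κ a).real C := (κ.measurable_coe hC).ennreal_toReal
  have hint : Integrable (fun ω => (κ (U ω)).real C) μ :=
    Integrable.of_bound (hκ.comp hU).aestronglyMeasurable 1
      (Eventually.of_forall fun ω => by
        rw [Real.norm_eq_abs, abs_of_nonneg measureReal_nonneg]
        exact measureReal_le_one)
  refine (ae_eq_condExp_of_forall_setIntegral_eq hU.comap_le
    ((integrable_const _).indicator hCm) (fun _ _ _ => hint.integrableOn) ?_ ?_).symm
  · rintro _ ⟨B, hB, rfl⟩ -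
    have h1 : μ (U ⁻¹' B ∩ {ω | X ω ∈ C}) = ∫⁻ ω in U ⁻¹' B, κ (U ω) C ∂μ := by
      have h2 := congrArg (fun m => m (B ×ˢ C)) h
      rw [Measure.map_apply (hU.prodMk hX) (hB.prod hC),
        Measure.compProd_apply_prod hB hC,
        setLIntegral_map hB (κ.measurable_coe hC) hU] at h2
      exact h2
    rw [integral_indicator hCm, Measure.restrict_restrict hCm, integral_const, smul_eq_mul,
      mul_one, measureReal_restrict_apply_univ, Set.inter_comm, measureReal_def, h1]
    simp only [measureReal_def]
    exact integral_toReal ((κ.measurable_coe hC).comp hU).aemeasurable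
      (Eventually.of_forall fun _ => measure_lt_top _ _)
  · exact ((hκ.comp (comap_measurable U)).stronglyMeasurable).aestronglyMeasurable

theorem lintegral_of_map_eq_compProd {Ω A E : Type*} [MeasurableSpace Ω]
    [MeasurableSpace A] [MeasurableSpace E] {μ : Measure Ω} [IsProbabilityMeasure μ]
    {U : Ω → A} {X : Ω → E} (hU : Measurable U) (hX : Measurable X) {κ : Kernel A E}
    [IsMarkovKernel κ] (h : μ.map (fun ω => (U ω, X ω)) = μ.map U ⊗ₘ κ)
    {f : A × E → ℝ≥0∞} (hf : Measurable f) :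
    ∫⁻ ω, f (U ω, X ω) ∂μ = ∫⁻ ω, ∫⁻ y, f (U ω, y) ∂(κ (U ω)) ∂μ := by
  rw [← lintegral_map hf (hU.prodMk hX), h, Measure.lintegral_compProd hf,
    lintegral_map hf.lintegral_kernel_prod_right' hU]

theorem map_eq_compProd_of_lintegral_mul {Ω A E : Type*} [MeasurableSpace Ω]
    [MeasurableSpace A] [MeasurableSpace E] {μ : Measure Ω} [IsProbabilityMeasure μ]
    {U : Ω → A} {X : Ω → E} (hU : Measurable U) (hX : Measurable X) {κ : Kernel A E}
    [IsMarkovKernel κ]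
    (h : ∀ (b : A → ℝ≥0∞) (g : E → ℝ≥0∞), Measurable b → Measurable g →
      ∫⁻ ω, b (U ω) * g (X ω) ∂μ = ∫⁻ ω, b (U ω) * ∫⁻ y, g y ∂(κ (U ω)) ∂μ) :
    μ.map (fun ω => (U ω, X ω)) = μ.map U ⊗ₘ κ := by
  have := Measure.isProbabilityMeasure_map (μ := μ) (hU.prodMk hX).aemeasurable
  refine Measure.ext_prod fun {B C} hB hC => ?_
  have h1 := h (B.indicator 1) (C.indicator 1) (measurable_one.indicator hB)
    (measurable_one.indicator hC)
  have h2 : ∀ ω, B.indicator (1 : A → ℝ≥0∞) (U ω) * C.indicator (1 : E → ℝ≥0∞) (X ω)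
      = ((fun ω => (U ω, X ω)) ⁻¹' (B ×ˢ C)).indicator 1 ω := fun ω => by
    by_cases hb : U ω ∈ B <;> by_cases hc : X ω ∈ C <;> simp [hb, hc, Set.indicator]
  have h3 : ∀ ω, B.indicator (1 : A → ℝ≥0∞) (U ω) * ∫⁻ y, C.indicator (1 : E → ℝ≥0∞) y ∂κ (U ω)
      = (U ⁻¹' B).indicator (fun ω => κ (U ω) C) ω := fun ω => by
    rw [lintegral_indicator_one hC]
    by_cases hb : U ω ∈ B <;> simp [hb, Set.indicator]
  simp only [h2, h3] at h1
  rw [lintegral_indicator_one ((hU.prodMk hX) (hB.prod hC)), lintegral_indicator (hU hB)] at h1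
  rw [Measure.map_apply (hU.prodMk hX) (hB.prod hC), Measure.compProd_apply_prod hB hC,
    setLIntegral_map hB (κ.measurable_coe hC) hU, h1]

/-! ### Independent increments -/

/-- It suffices to treat finitely many past times. Since `Y 0 = 0`, the values there are sums of
increments along a grid ending with `s, s + t`, and the last increment is independent of all earlier
ones. -/
theorem HasIndepIncrements.indepFun_pathPast {Ω : Type*} [MeasurableSpace Ω] {μ : Measure Ω}
    [IsProbabilityMeasure μ] {Y : ℝ≥0 → Ω → ℝ} (hY : HasIndepIncrements Y μ)
    (hm : ∀ t, Measurable (Y t)) (h0 : ∀ ω, Y 0 ω = 0) (s t : ℝ≥0) :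
    IndepFun (fun ω => pathPast s fun r => Y r ω) (fun ω => Y (s + t) ω - Y s ω) μ := by
  refine IndepFun.process_indepFun (fun r => hm r) ((hm _).sub (hm _)) fun I => ?_
  classical
  let l : List ℝ≥0 := (I.image Subtype.val).sort (· ≤ ·)
  have hls : ∀ i (hi : i < l.length), l[i] ≤ s := fun i hi => by
    have h1 : l[i] ∈ l := List.getElem_mem hi
    rw [Finset.mem_sort, Finset.mem_image] at h1
    obtain ⟨r, -, hr⟩ := h1
    rw [← hr]
    exact r.2
  have hsort : ∀ i j (hi : i < l.length) (hj : j < l.length), i ≤ j → l[i] ≤ l[j] :=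
    fun i j hi hj hij => by
      rcases hij.eq_or_lt with rfl | hij
      · exact le_rfl
      · exact List.pairwise_iff_getElem.1 (Finset.pairwise_sort (I.image Subtype.val) (· ≤ ·))
          i j hi hj hij
  -- The grid is `0`, the sorted past times, `s`, then `s + t` forever, so that it is monotone on
  -- all of `ℕ`.
  let u : ℕ → ℝ≥0 := fun k =>
    match k with
    | 0 => 0
    | i + 1 => if hi : i < l.length then l[i] else if i = l.length then s else s + t
  have hu : Monotone u := by
    refine monotone_nat_of_le_succ fun k => ?_
    rcases k with _ | i
    · exact zero_le
    · have hst : s ≤ s + t := le_self_add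
      change (if hi : i < l.length then l[i] else if i = l.length then s else s + t)
        ≤ (if hi : i + 1 < l.length then l[i + 1] else if i + 1 = l.length then s else s + t)
      split_ifs with h1 h2 h3 h4 h5 h6
      · exact hsort _ _ _ _ (Nat.le_succ i)
      · exact hls _ _
      · exact (hls _ _).trans hst
      all_goals first | omega | exact hst | exact le_rfl
  have hinc := (hY.nat hu).indepFun_finset (Finset.range (l.length + 1)) {l.length + 1}
    (by simp) (fun i => (hm _).sub (hm _))
  have hsum : ∀ k ω, Y (u k) ω = ∑ i ∈ Finset.range k, (Y (u (i + 1)) ω - Y (u i) ω) := fun k ω => by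
    rw [Finset.sum_range_sub (fun i => Y (u i) ω)]
    simp [u, h0]
  have hidx : ∀ r : I, ∃ k ≤ l.length, u k = r.1.1 := fun r => by
    have h1 : r.1.1 ∈ l := by
      rw [Finset.mem_sort]
      exact Finset.mem_image_of_mem _ r.2
    obtain ⟨i, hi, he⟩ := List.getElem_of_mem h1
    exact ⟨i + 1, hi, by simp [u, hi, he]⟩
  choose k hk huk using hidx
  refine (IndepFun.comp hinc
    (φ := fun (x : Finset.range (l.length + 1) → ℝ) (r : I) =>
      ∑ i ∈ (Finset.range (k r)).attach,
        x ⟨i.1, Finset.mem_range.2 (by have := Finset.mem_range.1 i.2; have := hk r; omega)⟩)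
    (ψ := fun (x : ({l.length + 1} : Finset ℕ) → ℝ) => x ⟨_, Finset.mem_singleton_self _⟩)
    (by fun_prop) (by fun_prop)).congr ?_ ?_
  · refine Eventually.of_forall fun ω => funext fun r => ?_
    change ∑ i ∈ (Finset.range (k r)).attach, (Y (u (i.1 + 1)) ω - Y (u i.1) ω) = Y r.1.1 ω
    rw [Finset.sum_attach _ fun i => Y (u (i + 1)) ω - Y (u i) ω, ← hsum, huk]
  · refine Eventually.of_forall fun ω => ?_
    have h1 : u (l.length + 1) = s := by simp [u]
    have h2 : u (l.length + 1 + 1) = s + t := by simp [u]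
    change Y (u (l.length + 1 + 1)) ω - Y (u (l.length + 1)) ω = _
    rw [h1, h2]

/-! ### Laws of Markov processes depend measurably on the starting point -/

/-- The conditional probability, given that the process is at `y` at time `s`, of visiting the
prescribed sets at the prescribed times. -/
noncomputable def cylinderProb {E : Type*} [MeasurableSpace E] (R : ℝ≥0 → Kernel E E) :
    ℝ≥0 → List (ℝ≥0 × Set E) → E → ℝ≥0∞
  | _, [] => fun _ => 1
  | s, p :: l => fun y => ∫⁻ z, p.2.indicator (cylinderProb R p.1 l) z ∂(R (p.1 - s) y)

theorem measurable_cylinderProb {E : Type*} [MeasurableSpace E] (R : ℝ≥0 → Kernel E E)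
    (s : ℝ≥0) (l : List (ℝ≥0 × Set E)) (hl : ∀ p ∈ l, MeasurableSet p.2) :
    Measurable (cylinderProb R s l) := by
  induction l generalizing s with
  | nil => exact measurable_const
  | cons p l ih =>
    refine Measurable.lintegral_kernel ?_
    exact (ih _ fun q hq => hl q (List.mem_cons_of_mem _ hq)).indicator (hl p List.mem_cons_self)

/-- The event that a path visits the prescribed sets at the prescribed times. -/
def pathCylinder {E : Type*} [TopologicalSpace E] (l : List (ℝ≥0 × Set E)) :
    Set (CadlagPath E) := {w | ∀ p ∈ l, w.1 p.1 ∈ p.2}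

theorem measurableSet_pathCylinder {E : Type*} [TopologicalSpace E] [MeasurableSpace E]
    {l : List (ℝ≥0 × Set E)} (hl : ∀ p ∈ l, MeasurableSet p.2) :
    MeasurableSet (pathCylinder l) := by
  have : pathCylinder l = ⋂ p ∈ {p | p ∈ l}, (fun w : CadlagPath E => w.1 p.1) ⁻¹' p.2 := by
    ext w
    simp [pathCylinder]
  rw [this]
  exact MeasurableSet.biInter (List.finite_toSet l).countable fun p hp =>
    ((measurable_pi_apply p.1).comp measurable_subtype_coe) (hl p hp)

/-- Induction on the visiting times, with the time `s` and the weight `b` left free: the indicator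
of the first visit is absorbed into the weight, the remaining visits are treated from that time on,
and the Markov property then goes back to `s`. -/
theorem lintegral_pathCylinder {E : Type*} [TopologicalSpace E] [MeasurableSpace E]
    {μ : Measure (CadlagPath E)} [IsProbabilityMeasure μ] {R : ℝ≥0 → Kernel E E}
    [∀ t, IsMarkovKernel (R t)]
    (hμ : ∀ s t : ℝ≥0, μ.map (fun w => (pathPast s w.1, w.1 (s + t)))
      = μ.map (fun w => pathPast s w.1) ⊗ₘ
        ((R t).comap (presentState s) (measurable_presentState s)))
    (l : List (ℝ≥0 × Set E)) (hl : ∀ p ∈ l, MeasurableSet p.2)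
    (s : ℝ≥0) (hs : ∀ p ∈ l, s ≤ p.1) (hsort : l.Pairwise fun p q => p.1 ≤ q.1)
    (b : (Set.Iic s → E) → ℝ≥0∞) (hb : Measurable b) :
    ∫⁻ w, b (pathPast s w.1) * (pathCylinder l).indicator 1 w ∂μ
      = ∫⁻ w, b (pathPast s w.1) * cylinderProb R s l (w.1 s) ∂μ := by
  have hev : ∀ t, Measurable fun w : CadlagPath E => w.1 t := fun t =>
    (measurable_pi_apply t).comp measurable_subtype_coe
  induction l generalizing s with
  | nil => simp [pathCylinder, cylinderProb]
  | cons p l ih =>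
    obtain ⟨r, A⟩ := p
    have hA : MeasurableSet A := hl _ List.mem_cons_self
    have hl' : ∀ p ∈ l, MeasurableSet p.2 := fun q hq => hl q (List.mem_cons_of_mem _ hq)
    have hsr : s ≤ r := hs _ List.mem_cons_self
    rw [List.pairwise_cons] at hsort
    have hG := (measurable_cylinderProb R r l hl').indicator hA
    have h1 := ih hl' r hsort.1 hsort.2
      (fun u => b (fun x => u ⟨x.1, x.2.trans hsr⟩) * A.indicator 1 (presentState r u))
      ((hb.comp (measurable_pi_lambda _ fun x => measurable_pi_apply _)).mul
        ((measurable_one.indicator hA).comp (measurable_presentState r)))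
    have h2 := lintegral_of_map_eq_compProd (measurable_pathPast hev s) (hev (s + (r - s)))
      (hμ s (r - s)) (f := fun q => b q.1 * A.indicator (cylinderProb R r l) q.2)
      ((hb.comp measurable_fst).mul (hG.comp measurable_snd))
    rw [add_tsub_cancel_of_le hsr] at h2
    calc _ = ∫⁻ w, b (pathPast s w.1) * A.indicator 1 (w.1 r)
            * (pathCylinder l).indicator 1 w ∂μ := by
          refine lintegral_congr fun w => ?_
          rw [mul_assoc]
          congr 1
          by_cases ha : w.1 r ∈ A <;> by_cases hc : w ∈ pathCylinder l
          · rw [Set.indicator_of_mem ha, Set.indicator_of_mem hc, Set.indicator_of_mem]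
            · simp
            · exact List.forall_mem_cons.2 ⟨ha, hc⟩
          · rw [Set.indicator_of_notMem hc, Set.indicator_of_notMem, mul_zero]
            exact fun h => hc (List.forall_mem_cons.1 h).2
          · rw [Set.indicator_of_notMem ha, Set.indicator_of_notMem, zero_mul]
            exact fun h => ha (List.forall_mem_cons.1 h).1
          · rw [Set.indicator_of_notMem ha, Set.indicator_of_notMem, zero_mul]
            exact fun h => ha (List.forall_mem_cons.1 h).1
      _ = ∫⁻ w, b (pathPast s w.1) * A.indicator 1 (w.1 r) * cylinderProb R r l (w.1 r) ∂μ := h1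
      _ = ∫⁻ w, b (pathPast s w.1) * A.indicator (cylinderProb R r l) (w.1 r) ∂μ := by
          refine lintegral_congr fun w => ?_
          rw [mul_assoc]
          congr 1
          by_cases ha : w.1 r ∈ A <;> simp [ha]
      _ = _ := by
          refine h2.trans (lintegral_congr fun w => ?_)
          rw [cylinderProb]
          exact lintegral_const_mul (μ := R (r - s) (w.1 s)) (b (pathPast s w.1)) hG

/-- Cylinders form a generating π-system, and the probability of one, once its times are sorted, is
an iterated kernel integral evaluated at the starting point. -/
theorem measurable_law_of_markov {E : Type*} [TopologicalSpace E] [MeasurableSpace E]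
    {P : E → Measure (CadlagPath E)} [∀ z, IsProbabilityMeasure (P z)] {R : ℝ≥0 → Kernel E E}
    [∀ t, IsMarkovKernel (R t)] (h0 : ∀ z, ∀ᵐ w ∂(P z), w.1 0 = z)
    (hP : ∀ (z : E) (s t : ℝ≥0), (P z).map (fun w => (pathPast s w.1, w.1 (s + t)))
      = (P z).map (fun w => pathPast s w.1) ⊗ₘ
        ((R t).comap (presentState s) (measurable_presentState s))) :
    Measurable P := by
  refine Measurable.measure_of_isPiSystem_of_isProbabilityMeasure
    (S := {B | ∃ l : List (ℝ≥0 × Set E), (∀ p ∈ l, MeasurableSet p.2) ∧ pathCylinder l = B})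
    (le_antisymm ?_ ?_) ?_ ?_
  · change MeasurableSpace.comap Subtype.val MeasurableSpace.pi ≤ _
    rw [MeasurableSpace.pi, MeasurableSpace.comap_iSup]
    refine iSup_le fun t => ?_
    rw [MeasurableSpace.comap_comp]
    rintro _ ⟨A, hA, rfl⟩
    refine MeasurableSpace.measurableSet_generateFrom ⟨[(t, A)], by simpa using hA, ?_⟩
    ext w
    simp [pathCylinder]
  · refine MeasurableSpace.generateFrom_le ?_
    rintro _ ⟨l, hl, rfl⟩
    exact measurableSet_pathCylinder hl
  · rintro _ ⟨l, hl, rfl⟩ _ ⟨l', hl', rfl⟩ -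
    refine ⟨l ++ l', fun p hp => (List.mem_append.1 hp).elim (hl p) (hl' p), ?_⟩
    ext w
    simp only [pathCylinder, List.mem_append, Set.mem_inter_iff, Set.mem_ofPred_eq, or_imp,
      forall_and]
  · rintro _ ⟨l, hl, rfl⟩
    classical
    let l' := l.insertionSort fun p q => p.1 ≤ q.1
    have hmem : ∀ p, p ∈ l' ↔ p ∈ l := fun p => List.mem_insertionSort _
    have hcyl : pathCylinder l = pathCylinder l' := by
      ext w
      simp only [pathCylinder, hmem]
    have hl' : ∀ p ∈ l', MeasurableSet p.2 := fun p hp => hl p ((hmem p).1 hp)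
    have : Std.Total fun p q : ℝ≥0 × Set E => p.1 ≤ q.1 := ⟨fun p q => le_total _ _⟩
    have : IsTrans (ℝ≥0 × Set E) fun p q => p.1 ≤ q.1 := ⟨fun p q r => le_trans⟩
    have hsort : l'.Pairwise fun p q => p.1 ≤ q.1 := List.pairwise_insertionSort _ l
    have h1 : ∀ z, P z (pathCylinder l) = cylinderProb R 0 l' z := fun z => by
      have h2 := lintegral_pathCylinder (hP z) l' hl' 0 (fun p _ => zero_le) hsort
        (fun _ => 1) measurable_const
      simp only [one_mul] at h2
      rw [lintegral_indicator_one (measurableSet_pathCylinder hl')] at h2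
      rw [hcyl, h2, lintegral_congr_ae (g := fun _ => cylinderProb R 0 l' z)
        ((h0 z).mono fun w hw => by rw [hw])]
      simp
    simp only [h1]
    exact measurable_cylinderProb R 0 l' hl'

/-! ### Transition kernels of Feller processes -/

theorem IsFellerSemigroup.norm_sub_le {𝓜 : Type*} [TopologicalSpace 𝓜]
    {S : ℝ≥0 → C₀(𝓜, ℝ) →L[ℝ] C₀(𝓜, ℝ)} (hS : IsFellerSemigroup S) (f : C₀(𝓜, ℝ)) {s t : ℝ≥0}
    (hst : s ≤ t) : ‖S t f - S s f‖ ≤ ‖S (t - s) f - f‖ := by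
  have h : S t f - S s f = S s (S (t - s) f - f) := by
    rw [map_sub, ← hS.add, add_tsub_cancel_of_le hst]
  rw [h]
  exact hS.contraction _ _

/-- Contractivity bounds the variation between two times by the variation from time `0` over their
difference, so continuity at `0` suffices. -/
theorem IsFellerSemigroup.continuous {𝓜 : Type*} [TopologicalSpace 𝓜]
    {S : ℝ≥0 → C₀(𝓜, ℝ) →L[ℝ] C₀(𝓜, ℝ)} (hS : IsFellerSemigroup S) (f : C₀(𝓜, ℝ)) :
    Continuous fun t => S t f := by
  have h0 : Tendsto (fun t => ‖S t f - f‖) (𝓝 0) (𝓝 0) := by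
    simpa using ((hS.strongly_continuous f).sub_const f).norm
  refine continuous_iff_continuousAt.2 fun t => ?_
  refine tendsto_iff_norm_sub_tendsto_zero.2 ?_
  have h1 : Tendsto (fun s : ℝ≥0 => s - t) (𝓝 t) (𝓝 0) := by
    have : Continuous fun s : ℝ≥0 => s - t := by fun_prop
    simpa using this.tendsto t
  have h2 : Tendsto (fun s : ℝ≥0 => t - s) (𝓝 t) (𝓝 0) := by
    have : Continuous fun s : ℝ≥0 => t - s := by fun_prop
    simpa using this.tendsto t
  refine squeeze_zero (fun _ => norm_nonneg _) (fun s => ?_)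
    (by simpa using (h0.comp h1).add (h0.comp h2))
  rcases le_total t s with h | h
  · exact (hS.norm_sub_le f h).trans (le_add_of_nonneg_right (norm_nonneg _))
  · rw [norm_sub_rev]
    exact (hS.norm_sub_le f h).trans (le_add_of_nonneg_left (norm_nonneg _))

theorem IsFellerSemigroup.continuous_apply {𝓜 : Type*} [TopologicalSpace 𝓜]
    {S : ℝ≥0 → C₀(𝓜, ℝ) →L[ℝ] C₀(𝓜, ℝ)} (hS : IsFellerSemigroup S) (f : C₀(𝓜, ℝ)) :
    Continuous fun q : ℝ≥0 × 𝓜 => S q.1 f q.2 := by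
  have h1 : Continuous fun q : ℝ≥0 × 𝓜 =>
      (ZeroAtInftyContinuousMap.toBCF (S q.1 f), q.2) :=
    (((ZeroAtInftyContinuousMap.isometry_toBCF).continuous.comp
      ((hS.continuous f).comp continuous_fst)).prodMk continuous_snd)
  exact ContinuousEval.continuous_eval.comp h1

/-- An open set is an increasing union of closed sets `F n`; Urysohn functions equal to one on the
compact `F n ∩ compactCovering X n` and compactly supported in `U` converge pointwise. -/
theorem IsOpen.exists_seq_continuous_tendsto_indicator {X : Type*} [TopologicalSpace X]
    [T2Space X] [LocallyCompactSpace X] [SecondCountableTopology X] {U : Set X} (hU : IsOpen U) :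
    ∃ f : ℕ → C₀(X, ℝ), (∀ n x, f n x ∈ Set.Icc 0 1) ∧
      ∀ x, Tendsto (fun n => f n x) atTop (𝓝 (U.indicator 1 x)) := by
  let := TopologicalSpace.metrizableSpaceMetric X
  obtain ⟨F, hF, hFU, hFe, hFm⟩ := hU.exists_iUnion_isClosed
  have hK : ∀ n, ∃ f : C(X, ℝ), Set.EqOn f 1 (F n ∩ compactCovering X n) ∧
      IsCompact (tsupport f) ∧ tsupport f ⊆ U ∧ ∀ x, f x ∈ Set.Icc 0 1 := fun n =>
    exists_continuousMap_one_of_isCompact_subset_isOpen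
      ((isCompact_compactCovering X n).inter_left (hF n)) hU
      (Set.inter_subset_left.trans (hFe ▸ Set.subset_iUnion F n))
  choose f hf1 hfc hfU hf01 using hK
  refine ⟨fun n => ⟨f n, (HasCompactSupport.is_zero_at_infty (hfc n))⟩, hf01, fun x => ?_⟩
  by_cases hx : x ∈ U
  · rw [← hFe, Set.mem_iUnion] at hx
    obtain ⟨i, hi⟩ := hx
    obtain ⟨j, hj⟩ := Set.mem_iUnion.1 ((iUnion_compactCovering X).symm ▸ Set.mem_univ x)
    refine tendsto_const_nhds.congr' ?_
    filter_upwards [eventually_ge_atTop (max i j)] with n hn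
    have h1 : f n x = 1 := hf1 n ⟨hFm ((le_max_left i j).trans hn) hi,
      compactCovering_subset X ((le_max_right i j).trans hn) hj⟩
    rw [Set.indicator_of_mem (hFe ▸ Set.mem_iUnion_of_mem i hi)]
    exact h1.symm
  · refine tendsto_const_nhds.congr fun n => ?_
    rw [Set.indicator_of_notMem hx]
    exact (image_eq_zero_of_notMem_tsupport fun h => hx (hfU n h)).symm

/-- A family of probability measures on a locally compact second countable space depends
measurably on its parameter as soon as the integrals of functions vanishing at infinity do. -/
theorem measurable_measure_of_integral_zeroAtInfty {α X : Type*} [MeasurableSpace α]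
    [TopologicalSpace X] [T2Space X] [LocallyCompactSpace X] [SecondCountableTopology X]
    [MeasurableSpace X] [BorelSpace X] {μ : α → Measure X} [∀ a, IsProbabilityMeasure (μ a)]
    (h : ∀ f : C₀(X, ℝ), Measurable fun a => ∫ x, f x ∂(μ a)) : Measurable μ := by
  refine Measurable.measure_of_isPiSystem_of_isProbabilityMeasure
    (BorelSpace.measurable_eq (α := X)) isPiSystem_isOpen fun U hU => ?_
  have hU' : IsOpen U := hU
  obtain ⟨f, hf01, hf⟩ := hU'.exists_seq_continuous_tendsto_indicator
  have hlim : ∀ a, Tendsto (fun n => ∫ x, f n x ∂(μ a)) atTop (𝓝 ((μ a).real U)) := fun a => by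
    rw [← integral_indicator_one hU'.measurableSet]
    refine tendsto_integral_of_dominated_convergence (fun _ => 1)
      (fun n => (f n).continuous.measurable.aestronglyMeasurable) (integrable_const _)
      (fun n => Eventually.of_forall fun x => ?_) (Eventually.of_forall hf)
    rw [Real.norm_eq_abs, abs_of_nonneg (hf01 n x).1]
    exact (hf01 n x).2
  have hm : Measurable fun a => (μ a).real U :=
    measurable_of_tendsto_metrizable (fun n => h (f n)) (tendsto_pi_nhds.2 hlim)
  have : (fun a => μ a U) = fun a => ENNReal.ofReal ((μ a).real U) := by
    ext a
    simp
  rw [this]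
  exact hm.ennreal_ofReal

theorem IsMarkovWithSemigroup.setIntegral_eq {𝓜 Ω : Type*} [TopologicalSpace 𝓜]
    [MeasurableSpace 𝓜] [BorelSpace 𝓜] [MeasurableSpace Ω]
    {S : ℝ≥0 → C₀(𝓜, ℝ) →L[ℝ] C₀(𝓜, ℝ)} {M : ℝ≥0 → Ω → 𝓜} {hMm : ∀ t, Measurable (M t)}
    {x : 𝓜} {μ : Measure Ω} [IsProbabilityMeasure μ] (hM : IsMarkovWithSemigroup S M hMm x μ)
    (s t : ℝ≥0) (f : C₀(𝓜, ℝ)) {B : Set (Set.Iic s → 𝓜)} (hB : MeasurableSet B) :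
    ∫ ω in (fun ω => pathPast s fun r => M r ω) ⁻¹' B, f (M (s + t) ω) ∂μ
      = ∫ ω in (fun ω => pathPast s fun r => M r ω) ⁻¹' B, S t f (M s ω) ∂μ := by
  have hint : Integrable (fun ω => f (M (s + t) ω)) μ :=
    Integrable.of_bound (f.continuous.measurable.comp (hMm _)).aestronglyMeasurable ‖f‖
      (Eventually.of_forall fun ω => f.toBCF.norm_coe_le_norm _)
  have hF : MeasurableSet[naturalFiltration M hMm s]
      ((fun ω => pathPast s fun r => M r ω) ⁻¹' B) := by
    rw [naturalFiltration_eq_comap]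
    exact ⟨B, hB, rfl⟩
  rw [← setIntegral_condExp ((naturalFiltration M hMm).le s) hint hF]
  exact setIntegral_congr_ae ((naturalFiltration M hMm).le s _ hF)
    ((hM.markov s t f).mono fun ω hω _ => hω)

theorem IsMarkovWithSemigroup.integral_eq {𝓜 Ω : Type*} [TopologicalSpace 𝓜]
    [MeasurableSpace 𝓜] [BorelSpace 𝓜] [MeasurableSpace Ω]
    {S : ℝ≥0 → C₀(𝓜, ℝ) →L[ℝ] C₀(𝓜, ℝ)} {M : ℝ≥0 → Ω → 𝓜} {hMm : ∀ t, Measurable (M t)}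
    {x : 𝓜} {μ : Measure Ω} [IsProbabilityMeasure μ] (hM : IsMarkovWithSemigroup S M hMm x μ)
    (t : ℝ≥0) (f : C₀(𝓜, ℝ)) : ∫ ω, f (M t ω) ∂μ = S t f x := by
  have h := hM.setIntegral_eq 0 t f MeasurableSet.univ
  rw [Set.preimage_univ, setIntegral_univ, setIntegral_univ, zero_add] at h
  rw [h, integral_congr_ae (hM.initial.mono fun ω hω => congrArg (S t f) hω)]
  simp

/-- The Markov property for test functions in `C₀` identifies the joint law of the past and a
future state. -/
theorem IsMarkovWithSemigroup.map_past_eq {𝓜 Ω : Type*} [TopologicalSpace 𝓜] [T2Space 𝓜]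
    [LocallyCompactSpace 𝓜] [SecondCountableTopology 𝓜]
    [MeasurableSpace 𝓜] [BorelSpace 𝓜] [MeasurableSpace Ω]
    {S : ℝ≥0 → C₀(𝓜, ℝ) →L[ℝ] C₀(𝓜, ℝ)} {M : ℝ≥0 → Ω → 𝓜} {hMm : ∀ t, Measurable (M t)}
    {x : 𝓜} {μ : Measure Ω} [IsProbabilityMeasure μ] (hM : IsMarkovWithSemigroup S M hMm x μ)
    (s t : ℝ≥0) {κ : Kernel 𝓜 𝓜} [IsMarkovKernel κ]
    (hκ : ∀ (f : C₀(𝓜, ℝ)) y, ∫ z, f z ∂(κ y) = S t f y) :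
    μ.map (fun ω => (pathPast s fun r => M r ω, M (s + t) ω))
      = μ.map (fun ω => pathPast s fun r => M r ω) ⊗ₘ
        (κ.comap (presentState s) (measurable_presentState s)) := by
  have hU : Measurable fun ω => pathPast s fun r => M r ω := measurable_pathPast hMm s
  have := Measure.isProbabilityMeasure_map (μ := μ) (hU.prodMk (hMm (s + t))).aemeasurable
  refine Measure.ext_prod fun {B C} hB hC => ?_
  -- With the past event `B` fixed, both sides are finite measures on `𝓜`, so compactly supported
  -- test functions, which lie in `C₀`, determine them.
  have key : (μ.restrict ((fun ω => pathPast s fun r => M r ω) ⁻¹' B)).map (M (s + t))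
      = κ ∘ₘ (μ.restrict ((fun ω => pathPast s fun r => M r ω) ⁻¹' B)).map (M s) := by
    refine Measure.ext_of_integral_eq_on_compactlySupported fun f => ?_
    let g : C₀(𝓜, ℝ) := ⟨f.toContinuousMap, f.hasCompactSupport.is_zero_at_infty⟩
    have h1 := hM.setIntegral_eq s t g hB
    change ∫ y, g y ∂_ = ∫ y, g y ∂_
    have hg : Measurable g := g.continuous.measurable
    have hc : ∀ m : Measure 𝓜, IsFiniteMeasure m →
        ∫ y, g y ∂(κ ∘ₘ m) = ∫ y, ∫ z, g z ∂(κ y) ∂m := fun m _ => by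
      have hi : Integrable g ((κ ∘ₖ Kernel.const Unit m) ()) :=
        Integrable.of_bound hg.aestronglyMeasurable ‖g‖
          (Eventually.of_forall fun y => g.toBCF.norm_coe_le_norm y)
      simpa [Kernel.comp_apply] using Kernel.integral_comp hi
    rw [integral_map (hMm _).aemeasurable hg.aestronglyMeasurable, h1, hc _ inferInstance]
    simp only [hκ]
    exact (integral_map (hMm _).aemeasurable
      (S t g).continuous.measurable.aestronglyMeasurable).symm
  rw [Measure.map_apply (hU.prodMk (hMm _)) (hB.prod hC), Measure.compProd_apply_prod hB hC,
    setLIntegral_map hB (Kernel.measurable_coe _ hC) hU]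
  have h3 : (μ.restrict ((fun ω => pathPast s fun r => M r ω) ⁻¹' B)).map (M (s + t)) C
      = μ ((fun ω => (pathPast s fun r => M r ω, M (s + t) ω)) ⁻¹' (B ×ˢ C)) := by
    rw [Measure.map_apply (hMm _) hC, Measure.restrict_apply (hMm _ hC), Set.inter_comm]
    rfl
  rw [← h3, key, Measure.bind_apply hC κ.aemeasurable,
    lintegral_map (κ.measurable_coe hC) (hMm s)]
  rfl

/-! ### Time change by an independent clock with independent increments -/

/-- The law of the state and of the elapsed clock `u` when a process with transition kernels
`p (u, ·)` is run for a random time with law `ρ`. -/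
noncomputable def timeChangedKernel {E : Type*} [MeasurableSpace E] (p : Kernel (ℝ≥0 × E) E)
    (ρ : Measure ℝ) : Kernel E (E × ℝ) :=
  ((Kernel.const E ρ) ⊗ₖ p.comap (fun q : E × ℝ => (q.2.toNNReal, q.1))
    (measurable_snd.real_toNNReal.prodMk measurable_fst)).map Prod.swap

instance {E : Type*} [MeasurableSpace E] (p : Kernel (ℝ≥0 × E) E) (ρ : Measure ℝ)
    [IsMarkovKernel p] [IsProbabilityMeasure ρ] : IsMarkovKernel (timeChangedKernel p ρ) :=
  Kernel.IsMarkovKernel.map _ measurable_swap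

theorem lintegral_timeChangedKernel {E : Type*} [MeasurableSpace E] (p : Kernel (ℝ≥0 × E) E)
    (ρ : Measure ℝ) [IsMarkovKernel p] [IsProbabilityMeasure ρ] (y : E) {g : E × ℝ → ℝ≥0∞}
    (hg : Measurable g) :
    ∫⁻ q, g q ∂(timeChangedKernel p ρ y)
      = ∫⁻ d, ∫⁻ z, g (z, d) ∂(p (d.toNNReal, y)) ∂ρ := by
  have hg' : Measurable fun q : ℝ × E => g q.swap := hg.comp measurable_swap
  rw [timeChangedKernel, Kernel.map_apply _ measurable_swap, lintegral_map hg measurable_swap,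
    Kernel.lintegral_compProd _ _ _ hg']
  rfl

/-- Passes from independence in the space of all paths to the càdlàg path space, on which evaluation
at a varying time is measurable. -/
theorem IndepFun.codRestrict {Ω A B : Type*} [MeasurableSpace Ω] [MeasurableSpace A]
    [MeasurableSpace B] {μ : Measure Ω} {p : A → Prop} {q : B → Prop} {f : Ω → A} {g : Ω → B}
    (h : IndepFun f g μ) (hf : ∀ ω, p (f ω)) (hg : ∀ ω, q (g ω)) :
    IndepFun (fun ω => (⟨f ω, hf ω⟩ : Subtype p)) (fun ω => (⟨g ω, hg ω⟩ : Subtype q)) μ := by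
  rw [IndepFun_iff_Indep] at h ⊢
  have e1 : MeasurableSpace.comap (fun ω => (⟨f ω, hf ω⟩ : Subtype p)) inferInstance
      = MeasurableSpace.comap f inferInstance := MeasurableSpace.comap_comp
  have e2 : MeasurableSpace.comap (fun ω => (⟨g ω, hg ω⟩ : Subtype q)) inferInstance
      = MeasurableSpace.comap g inferInstance := MeasurableSpace.comap_comp
  rw [e1, e2]
  exact h

theorem IndepFun.lintegral_eq {Ω A B : Type*} [MeasurableSpace Ω] [MeasurableSpace A]
    [MeasurableSpace B] {μ : Measure Ω} [IsProbabilityMeasure μ] {f : Ω → A} {g : Ω → B}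
    (h : IndepFun f g μ) (hf : Measurable f) (hg : Measurable g) {K : A × B → ℝ≥0∞}
    (hK : Measurable K) :
    ∫⁻ ω, K (f ω, g ω) ∂μ = ∫⁻ ω, ∫⁻ ω', K (f ω, g ω') ∂μ ∂μ := by
  have := Measure.isProbabilityMeasure_map (μ := μ) hf.aemeasurable
  have := Measure.isProbabilityMeasure_map (μ := μ) hg.aemeasurable
  rw [← lintegral_map hK (hf.prodMk hg),
    (indepFun_iff_map_prod_eq_prod_map_map hf.aemeasurable hg.aemeasurable).1 h,
    lintegral_prod _ hK.aemeasurable, lintegral_map hK.lintegral_prod_right' hf]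
  refine lintegral_congr fun ω => ?_
  exact lintegral_map (hK.comp measurable_prodMk_left) hg

/-- The pair formed by a process run along the clock `σ - σ 0` and by `σ`. -/
noncomputable def timeChangedPair {E Ω : Type*} (M : ℝ≥0 → Ω → E) (σ : ℝ≥0 → Ω → ℝ)
    (t : ℝ≥0) (ω : Ω) : E × ℝ := (M (clock σ t ω) ω, σ t ω)

/-- Monotonicity makes both increments nonnegative, so truncation is additive. The later clock time
is thus the earlier one plus a duration, as the Markov property of `M` requires. -/
theorem clock_add {Ω : Type*} {σ : ℝ≥0 → Ω → ℝ} (hσ : ∀ ω, Monotone fun t => σ t ω)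
    (s t : ℝ≥0) (ω : Ω) :
    clock σ (s + t) ω = clock σ s ω + (σ (s + t) ω - σ s ω).toNNReal := by
  rw [clock, clock, ← Real.toNNReal_add (sub_nonneg.2 (hσ ω zero_le))
    (sub_nonneg.2 (hσ ω le_self_add))]
  congr 1
  ring

theorem clock_mono {Ω : Type*} {σ : ℝ≥0 → Ω → ℝ} (hσ : ∀ ω, Monotone fun t => σ t ω) (ω : Ω) :
    Monotone fun t => clock σ t ω :=
  fun _ _ h => Real.toNNReal_le_toNNReal (sub_le_sub_right (hσ ω h) _)

theorem measurable_clock {Ω : Type*} [MeasurableSpace Ω] {σ : ℝ≥0 → Ω → ℝ}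
    (hσ : ∀ t, Measurable (σ t)) (t : ℝ≥0) : Measurable (clock σ t) :=
  ((hσ t).sub (hσ 0)).real_toNNReal

theorem map_past_timeChangedPair {E Ω : Type*} [TopologicalSpace E]
    [TopologicalSpace.PseudoMetrizableSpace E] [MeasurableSpace E] [BorelSpace E]
    [MeasurableSpace Ω] {μ : Measure Ω} [IsProbabilityMeasure μ]
    {M : ℝ≥0 → Ω → E} (hMm : ∀ t, Measurable (M t)) (hMc : ∀ ω, IsCadlag fun t => M t ω)
    {σ : ℝ≥0 → Ω → ℝ} (hσm : ∀ t, Measurable (σ t)) (hσc : ∀ ω, IsCadlag fun t => σ t ω)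
    (hσ : ∀ ω, Monotone fun t => σ t ω)
    {p : Kernel (ℝ≥0 × E) E} [IsMarkovKernel p] {ρ : Measure ℝ} [IsProbabilityMeasure ρ]
    (hM : ∀ s t : ℝ≥0, μ.map (fun ω => (pathPast s fun r => M r ω, M (s + t) ω))
      = μ.map (fun ω => pathPast s fun r => M r ω) ⊗ₘ
        ((p.comap (Prod.mk t) measurable_prodMk_left).comap (presentState s)
          (measurable_presentState s)))
    (hMσ : IndepFun (fun ω t => M t ω) (fun ω t => σ t ω) μ) {s t : ℝ≥0}
    (hinc : IndepFun (fun ω => pathPast s fun r => σ r ω) (fun ω => σ (s + t) ω - σ s ω) μ)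
    (hρ : μ.map (fun ω => σ (s + t) ω - σ s ω) = ρ) :
    μ.map (fun ω => (pathPast s fun r => timeChangedPair M σ r ω,
        (M (clock σ (s + t) ω) ω, σ (s + t) ω - σ s ω)))
      = μ.map (fun ω => pathPast s fun r => timeChangedPair M σ r ω) ⊗ₘ
        ((timeChangedKernel p ρ).comap (fun u => (presentState s u).1)
          (measurable_fst.comp (measurable_presentState s))) := by
  let Mp : Ω → CadlagPath E := fun ω => ⟨fun t => M t ω, hMc ω⟩
  let σp : Ω → CadlagPath ℝ := fun ω => ⟨fun t => σ t ω, hσc ω⟩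
  have hMp : Measurable Mp := (measurable_pi_lambda _ hMm).subtype_mk
  have hσp : Measurable σp := (measurable_pi_lambda _ hσm).subtype_mk
  have hfreeze : ∀ {K : CadlagPath E × CadlagPath ℝ → ℝ≥0∞}, Measurable K →
      ∫⁻ ω, K (Mp ω, σp ω) ∂μ = ∫⁻ ω, ∫⁻ ω', K (Mp ω, σp ω') ∂μ ∂μ := fun hK =>
    IndepFun.lintegral_eq (IndepFun.codRestrict hMσ hMc hσc) hMp hσp hK
  have hswap : ∀ {K : CadlagPath E × CadlagPath ℝ → ℝ≥0∞}, Measurable K →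
      ∫⁻ ω, ∫⁻ ω', K (Mp ω, σp ω') ∂μ ∂μ = ∫⁻ ω', ∫⁻ ω, K (Mp ω, σp ω') ∂μ ∂μ := fun hK =>
    lintegral_lintegral_swap (f := fun ω ω' => _)
      (hK.comp ((hMp.comp measurable_fst).prodMk (hσp.comp measurable_snd))).aemeasurable
  -- evaluation of the first path along the clock given by the second one
  let N : ℝ≥0 → CadlagPath E × CadlagPath ℝ → E := fun r q => q.1.1 (q.2.1 r - q.2.1 0).toNNReal
  have hw : ∀ r, Measurable fun q : CadlagPath E × CadlagPath ℝ => q.2.1 r := fun r =>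
    ((measurable_pi_apply r).comp measurable_subtype_coe).comp measurable_snd
  have hN : ∀ r, Measurable (N r) := fun r =>
    measurable_cadlagPath_eval.comp (((hw r).sub (hw 0)).real_toNNReal.prodMk measurable_fst)
  let Z : CadlagPath E × CadlagPath ℝ → Set.Iic s → E × ℝ := fun q r => (N r q, q.2.1 r)
  have hZ : Measurable Z := measurable_pi_lambda _ fun r => (hN r).prodMk (hw r)
  have hZr : ∀ r, Measurable fun ω => timeChangedPair M σ r ω := fun r =>
    ((hN r).prodMk (hw r)).comp (hMp.prodMk hσp)
  refine map_eq_compProd_of_lintegral_mul (measurable_pathPast hZr s)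
    (((hN (s + t)).comp (hMp.prodMk hσp)).prodMk ((hσm _).sub (hσm _)))
    fun b g hb hg => ?_
  -- The mean of `g` when the process is run from `q.2` for the known duration `q.1`.
  let H : (ℝ × E) → ℝ≥0∞ := fun q => ∫⁻ z, g (z, q.1) ∂(p (q.1.toNNReal, q.2))
  have hH : Measurable H := by
    have h1 : Measurable fun q : (ℝ × E) × E => g (q.2, q.1.1) :=
      hg.comp (measurable_snd.prodMk measurable_fst.fst)
    exact h1.lintegral_kernel_prod_right' (κ := p.comap (fun q : ℝ × E => (q.1.toNNReal, q.2))
      (measurable_fst.real_toNNReal.prodMk measurable_snd))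
  have hD : Measurable fun q : CadlagPath E × CadlagPath ℝ => q.2.1 (s + t) - q.2.1 s :=
    (hw _).sub (hw _)
  have hQ : Measurable fun y => ∫⁻ d, H (d, y) ∂ρ := hH.lintegral_prod_left'
  have hK1 : Measurable fun q => b (Z q) * g (N (s + t) q, q.2.1 (s + t) - q.2.1 s) :=
    (hb.comp hZ).mul (hg.comp ((hN _).prodMk hD))
  have hK2 : Measurable fun q => b (Z q) * H (q.2.1 (s + t) - q.2.1 s, N s q) :=
    (hb.comp hZ).mul (hH.comp (hD.prodMk (hN s)))
  have hK3 : Measurable fun q => b (Z q) * ∫⁻ d, H (d, N s q) ∂ρ :=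
    (hb.comp hZ).mul (hQ.comp (hN s))
  -- Here `σ` is frozen at `ω'`: the past of the pair is a function of `M` on `[0, a]`, and the
  -- Markov property of `M` applies at the deterministic time `a`.
  have step1 : ∀ ω', ∫⁻ ω, b (Z (Mp ω, σp ω'))
        * g (N (s + t) (Mp ω, σp ω'), σ (s + t) ω' - σ s ω') ∂μ
      = ∫⁻ ω, b (Z (Mp ω, σp ω')) * H (σ (s + t) ω' - σ s ω', N s (Mp ω, σp ω')) ∂μ := by
    intro ω'
    let a := clock σ s ω'
    let d := σ (s + t) ω' - σ s ω'
    let b' : (Set.Iic a → E) → ℝ≥0∞ := fun u =>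
      b fun r => (u ⟨clock σ r ω', clock_mono hσ ω' r.2⟩, σ r ω')
    have hb' : Measurable b' := hb.comp (measurable_pi_lambda _ fun r =>
      (measurable_pi_apply _).prodMk measurable_const)
    have hgd : Measurable fun y => g (y, d) := hg.comp measurable_prodMk_right
    have h1 := lintegral_of_map_eq_compProd (measurable_pathPast hMm a) (hMm _)
      (hM a d.toNNReal) (f := fun q => b' q.1 * g (q.2, d))
      ((hb'.comp measurable_fst).mul (hgd.comp measurable_snd))
    have h2 : clock σ (s + t) ω' = a + d.toNNReal := clock_add hσ s t ω'
    refine Eq.trans ?_ (h1.trans ?_)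
    · refine lintegral_congr fun ω => ?_
      rw [← h2]
      rfl
    · refine lintegral_congr fun ω => ?_
      exact lintegral_const_mul (μ := p (d.toNNReal, M a ω))
        (b' (pathPast a fun t => M t ω)) hgd
  -- Here `M` is frozen at `ω`: the past of the pair depends on `σ` only through its restriction to
  -- `[0, s]`, which contains time `0` and so determines the clock; the increment is independent of
  -- it.
  have step2 : ∀ ω, ∫⁻ ω', b (Z (Mp ω, σp ω'))
        * H (σ (s + t) ω' - σ s ω', N s (Mp ω, σp ω')) ∂μ
      = ∫⁻ ω', b (Z (Mp ω, σp ω')) * ∫⁻ d, H (d, N s (Mp ω, σp ω')) ∂ρ ∂μ := by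
    intro ω
    have hMω : Measurable (Mp ω).1 :=
      measurable_cadlagPath_eval.comp (measurable_id.prodMk measurable_const)
    let N' : Set.Iic s → (Set.Iic s → ℝ) → E := fun r u =>
      (Mp ω).1 (u r - u ⟨0, Set.mem_Iic.2 zero_le⟩).toNNReal
    have hev : ∀ r : Set.Iic s, Measurable fun u : Set.Iic s → ℝ => u r := measurable_pi_apply
    have hN' : ∀ r, Measurable (N' r) := fun r => hMω.comp ((hev r).sub (hev _)).real_toNNReal
    let Z' : (Set.Iic s → ℝ) → Set.Iic s → E × ℝ := fun u r => (N' r u, u r)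
    have hZ' : Measurable Z' := measurable_pi_lambda _ fun r =>
      (hN' r).prodMk (measurable_pi_apply r)
    have hK : Measurable fun q : (Set.Iic s → ℝ) × ℝ =>
        b (Z' q.1) * H (q.2, N' ⟨s, Set.self_mem_Iic⟩ q.1) :=
      ((hb.comp hZ').comp measurable_fst).mul
        (hH.comp (measurable_snd.prodMk ((hN' ⟨s, Set.self_mem_Iic⟩).comp measurable_fst)))
    refine (IndepFun.lintegral_eq hinc (measurable_pathPast hσm s)
      ((hσm _).sub (hσm _)) hK).trans (lintegral_congr fun ω' => ?_)
    have hHy : Measurable fun d => H (d, N s (Mp ω, σp ω')) := hH.comp measurable_prodMk_right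
    have hDσ : Measurable fun ω => σ (s + t) ω - σ s ω := (hσm _).sub (hσm _)
    rw [← hρ, lintegral_map hHy hDσ]
    exact lintegral_const_mul (b (Z (Mp ω, σp ω'))) (hHy.comp hDσ)
  calc _ = ∫⁻ ω, ∫⁻ ω', b (Z (Mp ω, σp ω'))
        * g (N (s + t) (Mp ω, σp ω'), σ (s + t) ω' - σ s ω') ∂μ ∂μ := hfreeze hK1
    _ = ∫⁻ ω, ∫⁻ ω', b (Z (Mp ω, σp ω'))
        * H (σ (s + t) ω' - σ s ω', N s (Mp ω, σp ω')) ∂μ ∂μ := by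
      exact (hswap hK1).trans ((lintegral_congr step1).trans (hswap hK2).symm)
    _ = ∫⁻ ω, ∫⁻ ω', b (Z (Mp ω, σp ω')) * ∫⁻ d, H (d, N s (Mp ω, σp ω')) ∂ρ ∂μ ∂μ :=
      lintegral_congr step2
    _ = ∫⁻ ω, b (Z (Mp ω, σp ω)) * ∫⁻ d, H (d, N s (Mp ω, σp ω)) ∂ρ ∂μ := (hfreeze hK3).symm
    _ = _ := by
      refine lintegral_congr fun ω => ?_
      rw [Kernel.comap_apply, lintegral_timeChangedKernel p ρ _ hg]
      rfl

/-! ### Markov additive processes on the path space -/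

/-- The transition kernel of the pair when the increments of the additive component, jointly with
the new state, are distributed according to `κ`. -/
noncomputable def additiveKernel {E : Type*} [MeasurableSpace E] (κ : Kernel E (E × ℝ)) :
    Kernel (E × ℝ) (E × ℝ) :=
  (Kernel.id ×ₖ κ.comap Prod.fst measurable_fst).map
    fun q : (E × ℝ) × (E × ℝ) => (q.2.1, q.1.2 + q.2.2)

theorem measurable_additive_shift {E : Type*} [MeasurableSpace E] :
    Measurable fun q : (E × ℝ) × (E × ℝ) => (q.2.1, q.1.2 + q.2.2) :=
  measurable_snd.fst.prodMk (measurable_fst.snd.add measurable_snd.snd)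

instance {E : Type*} [MeasurableSpace E] (κ : Kernel E (E × ℝ)) [IsMarkovKernel κ] :
    IsMarkovKernel (additiveKernel κ) :=
  Kernel.IsMarkovKernel.map _ measurable_additive_shift

theorem lintegral_additiveKernel {E : Type*} [MeasurableSpace E] (κ : Kernel E (E × ℝ))
    [IsMarkovKernel κ] (z : E × ℝ) {g : E × ℝ → ℝ≥0∞} (hg : Measurable g) :
    ∫⁻ q, g q ∂(additiveKernel κ z) = ∫⁻ q, g (q.1, z.2 + q.2) ∂(κ z.1) := by
  have hg' : Measurable fun q : (E × ℝ) × (E × ℝ) => g (q.2.1, q.1.2 + q.2.2) :=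
    hg.comp measurable_additive_shift
  rw [additiveKernel, Kernel.map_apply _ measurable_additive_shift,
    lintegral_map hg measurable_additive_shift, Kernel.prod_apply, lintegral_prod _ hg'.aemeasurable,
    Kernel.id_apply, lintegral_dirac' _ hg'.lintegral_prod_right']
  rfl

theorem additiveKernel_apply {E : Type*} [MeasurableSpace E] (κ : Kernel E (E × ℝ))
    [IsMarkovKernel κ] (z : E × ℝ) {C : Set (E × ℝ)} (hC : MeasurableSet C) :
    additiveKernel κ z C = κ z.1 {q | (q.1, z.2 + q.2) ∈ C} := by
  have hm : Measurable fun q : E × ℝ => (q.1, z.2 + q.2) :=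
    measurable_fst.prodMk (measurable_snd.const_add _)
  have h := lintegral_additiveKernel κ z (measurable_one.indicator hC)
  rw [lintegral_indicator_one hC] at h
  rw [h]
  exact lintegral_indicator_one (hm hC)

/-- A family of laws on the path space under which the conditional law, given the past, of the
next state and of the increment of the additive component is the value at the present state of a
kernel, defines a Markov additive process. -/
theorem isMarkovAdditiveWith_of_map_past {E : Type*} [TopologicalSpace E] [MeasurableSpace E]
    {P : E × ℝ → Measure (CadlagPath (E × ℝ))} [hPp : ∀ z, IsProbabilityMeasure (P z)]
    {Q : ℝ≥0 → Kernel E (E × ℝ)} [hQ : ∀ t, IsMarkovKernel (Q t)]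
    (h0 : ∀ z, ∀ᵐ w ∂(P z), w.1 0 = z)
    (hP : ∀ (z : E × ℝ) (s t : ℝ≥0),
      (P z).map (fun w => (pathPast s w.1, ((w.1 (s + t)).1, (w.1 (s + t)).2 - (w.1 s).2)))
        = (P z).map (fun w => pathPast s w.1) ⊗ₘ
          ((Q t).comap (fun u => (presentState s u).1)
            (measurable_fst.comp (measurable_presentState s)))) :
    IsMarkovAdditiveWith (canonicalFiltration (E × ℝ))
      (fun t (w : CadlagPath (E × ℝ)) => (w.1 t).1)
      (fun t (w : CadlagPath (E × ℝ)) => (w.1 t).2) P Q := by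
  have hev : ∀ t, Measurable fun w : CadlagPath (E × ℝ) => w.1 t := fun t =>
    (measurable_pi_apply t).comp measurable_subtype_coe
  have hpast : ∀ s, Measurable fun w : CadlagPath (E × ℝ) => pathPast s w.1 :=
    measurable_pathPast hev
  have hfil : ∀ s, (canonicalFiltration (E × ℝ) s : MeasurableSpace _)
      = MeasurableSpace.comap (fun w : CadlagPath (E × ℝ) => pathPast s w.1) inferInstance :=
    naturalFiltration_eq_comap _ hev
  have hinc : ∀ s t, Measurable fun w : CadlagPath (E × ℝ) =>
      ((w.1 (s + t)).1, (w.1 (s + t)).2 - (w.1 s).2) := fun s t =>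
    (hev _).fst.prodMk ((hev _).snd.sub (hev _).snd)
  -- The present value of the additive component is a function of the past, so adding it to the
  -- increment turns the hypothesis into the Markov property of the pair.
  have hR : ∀ (z : E × ℝ) (s t : ℝ≥0), (P z).map (fun w => (pathPast s w.1, w.1 (s + t)))
      = (P z).map (fun w => pathPast s w.1) ⊗ₘ
        ((additiveKernel (Q t)).comap (presentState s) (measurable_presentState s)) := by
    intro z s t
    refine map_eq_compProd_of_lintegral_mul (hpast s) (hev _) fun b g hb hg => ?_
    have hps : Measurable (presentState (E := E × ℝ) s) := measurable_presentState s
    have h1 := lintegral_of_map_eq_compProd (hpast s) (hinc s t) (hP z s t)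
      (f := fun q => b q.1 * g (q.2.1, (presentState s q.1).2 + q.2.2))
      ((hb.comp measurable_fst).mul (hg.comp (measurable_snd.fst.prodMk
        ((hps.comp measurable_fst).snd.add measurable_snd.snd))))
    refine Eq.trans (lintegral_congr fun w => ?_) (h1.trans (lintegral_congr fun w => ?_))
    · change _ = b (pathPast s w.1) * g ((w.1 (s + t)).1, (w.1 s).2
        + ((w.1 (s + t)).2 - (w.1 s).2))
      rw [add_sub_cancel]
    · rw [Kernel.comap_apply (additiveKernel (Q t)), lintegral_additiveKernel _ _ hg]
      refine lintegral_const_mul (μ := Q t (w.1 s).1) (b (pathPast s w.1)) ?_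
      exact hg.comp (measurable_fst.prodMk (measurable_snd.const_add (w.1 s).2))
  have hRC : ∀ (z : E × ℝ) (s t : ℝ≥0) {C : Set (E × ℝ)}, MeasurableSet C →
      P z {w | w.1 (s + t) ∈ C} = ∫⁻ w, additiveKernel (Q t) (w.1 s) C ∂(P z) := by
    intro z s t C hC
    have h1 := lintegral_of_map_eq_compProd (hpast s) (hev _) (hR z s t)
      (f := fun q => C.indicator 1 q.2) ((measurable_one.indicator hC).comp measurable_snd)
    refine (lintegral_indicator_one (hev (s + t) hC)).symm.trans
      (h1.trans (lintegral_congr fun w => ?_))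
    exact lintegral_indicator_one hC
  have hlaw : ∀ (z : E × ℝ) (t : ℝ≥0), (P z).map (fun w => w.1 t) = additiveKernel (Q t) z := by
    intro z t
    ext C hC
    rw [Measure.map_apply (hev t) hC]
    have h1 := hRC z 0 t hC
    rw [zero_add, lintegral_congr_ae (g := fun _ => additiveKernel (Q t) z C)
      ((h0 z).mono fun w hw => by rw [hw]), lintegral_const, measure_univ, mul_one] at h1
    exact h1
  have htrans : ∀ (t : ℝ≥0) (x : E), Q t x = (P (x, 0)).map fun w => w.1 t := by
    intro t x
    rw [hlaw]
    ext C hC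
    rw [additiveKernel_apply _ _ hC]
    simp
  refine ⟨⟨hQ, fun x => ?_, fun s t x C hC => ?_⟩, hPp, fun B hB => ?_, fun t => ?_, fun t => ?_,
    h0, htrans, fun z s t C hC => ?_, fun z s t C hC => ?_⟩
  · rw [htrans, Measure.map_congr (h0 (x, 0)), Measure.map_const, measure_univ, one_smul]
  · rw [htrans (s + t), Measure.map_apply (hev _) hC, htrans s]
    refine (hRC (x, 0) s t hC).trans ?_
    rw [← lintegral_map (f := fun p => additiveKernel (Q t) p C)
      (Kernel.measurable_coe _ hC) (hev s)]
    exact lintegral_congr fun p => additiveKernel_apply _ _ hC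
  · exact (Measure.measurable_coe hB).comp (measurable_law_of_markov h0 hR)
  · rw [hfil]
    exact (measurable_fst.comp (measurable_presentState t)).comp (comap_measurable _)
  · rw [hfil]
    exact (measurable_snd.comp (measurable_presentState t)).comp (comap_measurable _)
  · rw [hfil]
    refine (condExp_indicator_of_map_eq_compProd (hpast s) (hev _) (hR z s t) hC).trans
      (Eventually.of_forall fun w => ?_)
    change (additiveKernel (Q t) (w.1 s)).real C = (P (w.1 s)).real {w' | w'.1 t ∈ C}
    rw [← hlaw, map_measureReal_apply (hev t) hC]
    rfl
  · rw [hfil]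
    exact condExp_indicator_of_map_eq_compProd (hpast s) (hinc s t) (hP z s t) hC

/-! ### Increments of subordinators -/

/-- The increment is the coercion of the `ℝ≥0`-valued clock, so uniqueness of Laplace transforms
applies. -/
theorem HasSubordinatorLaw.map_eq {Ω : Type*} [MeasurableSpace Ω] {φ : ℝ → ℝ}
    {σ : ℝ≥0 → Ω → ℝ} (hσm : ∀ t, Measurable (σ t)) (hσ : ∀ ω, Monotone fun t => σ t ω)
    {μ ν : Measure Ω} [IsProbabilityMeasure μ] [IsProbabilityMeasure ν]
    (hμ : HasSubordinatorLaw φ (fun t ω => σ t ω - σ 0 ω) μ)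
    (hν : HasSubordinatorLaw φ (fun t ω => σ t ω - σ 0 ω) ν) (t : ℝ≥0) :
    μ.map (fun ω => σ t ω - σ 0 ω) = ν.map (fun ω => σ t ω - σ 0 ω) := by
  have hc : Measurable (clock σ t) := measurable_clock hσm t
  have hcoe : (fun ω => σ t ω - σ 0 ω) = fun ω => (clock σ t ω : ℝ) := by
    ext ω
    rw [clock, Real.coe_toNNReal _ (sub_nonneg.2 (hσ ω zero_le))]
  have key : μ.map (clock σ t) = ν.map (clock σ t) := by
    have := Measure.isProbabilityMeasure_map (μ := μ) hc.aemeasurable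
    have := Measure.isProbabilityMeasure_map (μ := ν) hc.aemeasurable
    refine measure_nnreal_ext_of_laplace fun l hl => ?_
    have hm : Measurable fun x : ℝ≥0 => Real.exp (-(l * x)) := by fun_prop
    rw [integral_map hc.aemeasurable hm.aestronglyMeasurable,
      integral_map hc.aemeasurable hm.aestronglyMeasurable]
    have h1 := hμ.laplace t l hl
    rw [← hν.laplace t l hl] at h1
    simp only [fun ω => congrFun hcoe ω] at h1
    exact h1
  rw [hcoe, ← Function.comp_def, ← Measure.map_map measurable_coe_nnreal_real hc, key,
    Measure.map_map measurable_coe_nnreal_real hc]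

theorem HasSubordinatorLaw.map_increment_eq {Ω : Type*} [MeasurableSpace Ω] {φ : ℝ → ℝ}
    {σ : ℝ≥0 → Ω → ℝ} {μ : Measure Ω}
    (hμ : HasSubordinatorLaw φ (fun t ω => σ t ω - σ 0 ω) μ) (s t : ℝ≥0) :
    μ.map (fun ω => σ (s + t) ω - σ s ω) = μ.map (fun ω => σ t ω - σ 0 ω) := by
  simpa using (hμ.stationary_increments s t).map_eq

theorem HasSubordinatorLaw.indepFun_pathPast {Ω : Type*} [MeasurableSpace Ω] {φ : ℝ → ℝ}
    {σ : ℝ≥0 → Ω → ℝ} (hσm : ∀ t, Measurable (σ t)) {μ : Measure Ω} [IsProbabilityMeasure μ]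
    (hμ : HasSubordinatorLaw φ (fun t ω => σ t ω - σ 0 ω) μ) {v : ℝ}
    (hv : ∀ᵐ ω ∂μ, σ 0 ω = v) (s t : ℝ≥0) :
    IndepFun (fun ω => pathPast s fun r => σ r ω) (fun ω => σ (s + t) ω - σ s ω) μ := by
  have h1 := HasIndepIncrements.indepFun_pathPast hμ.indep_increments
    (fun r => (hσm r).sub (hσm 0)) (fun ω => sub_self _) s t
  -- Since `σ 0 = v` almost surely, the past of `σ` is the past of `σ - σ 0` shifted by a constant.
  have hadd : Measurable fun (u : Set.Iic s → ℝ) r => u r + v := by fun_prop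
  refine (h1.comp hadd measurable_id).congr ?_ ?_
  · filter_upwards [hv] with ω hω
    funext r
    change σ r ω - σ 0 ω + v = σ r ω
    rw [hω, sub_add_cancel]
  · refine Eventually.of_forall fun ω => ?_
    change σ (s + t) ω - σ 0 ω - (σ s ω - σ 0 ω) = _
    ring

theorem measurable_pairPath {𝓜 Ω : Type*} [TopologicalSpace 𝓜]
    [TopologicalSpace.PseudoMetrizableSpace 𝓜] [MeasurableSpace 𝓜] [BorelSpace 𝓜]
    [MeasurableSpace Ω] {M : ℝ≥0 → Ω → 𝓜} {σ : ℝ≥0 → Ω → ℝ} (hMm : ∀ t, Measurable (M t))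
    (hσm : ∀ t, Measurable (σ t)) (hM : ∀ ω, IsCadlag fun t => M t ω)
    (hσ : ∀ ω, IsCadlag fun t => σ t ω) (hσmono : ∀ ω, Monotone fun t => σ t ω) :
    Measurable (pairPath M σ hM hσ hσmono) := by
  refine (measurable_pi_lambda _ fun t => ?_).subtype_mk
  exact ((measurable_uncurry_of_rightContinuous (fun ω t => (hM ω t).1) hMm).comp
    ((measurable_clock hσm t).prodMk measurable_id)).prodMk (hσm t)

theorem lemma4p1 {𝓜 Ω : Type*} [TopologicalSpace 𝓜] [T2Space 𝓜] [LocallyCompactSpace 𝓜]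
    [SecondCountableTopology 𝓜] [MeasurableSpace 𝓜] [BorelSpace 𝓜] [MeasurableSpace Ω]
    -- the family of laws `P^{(x,v)}`
    (P : 𝓜 × ℝ → Measure Ω) (hP : ∀ z, IsProbabilityMeasure (P z))
    -- the Feller process `M` with Feller semigroup `S`, started at `x` under `P^{(x,v)}`
    (S : ℝ≥0 → C₀(𝓜, ℝ) →L[ℝ] C₀(𝓜, ℝ)) (hS : IsFellerSemigroup S)
    (M : ℝ≥0 → Ω → 𝓜) (hM_meas : ∀ t, Measurable (M t))
    (hM_cadlag : ∀ ω, IsCadlag fun t => M t ω)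
    (hM : ∀ x v, IsMarkovWithSemigroup S M hM_meas x (P (x, v)))
    -- the process `σ`, started at `v` under `P^{(x,v)}`, such that `σ - σ(0)` is a subordinator
    -- with Laplace exponent `φ`
    (φ : ℝ → ℝ) (σ : ℝ≥0 → Ω → ℝ) (hσ_meas : ∀ t, Measurable (σ t))
    (hσ_cadlag : ∀ ω, IsCadlag fun t => σ t ω) (hσ_mono : ∀ ω, Monotone fun t => σ t ω)
    (hσ_init : ∀ x v, ∀ᵐ ω ∂(P (x, v)), σ 0 ω = v)
    (hσ : ∀ z, HasSubordinatorLaw φ (fun t ω => σ t ω - σ 0 ω) (P z))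
    -- independence of the two processes under each `P^{(x,v)}`
    (hMσ : ∀ z, IndepFun (fun ω t => M t ω) (fun ω t => σ t ω) (P z)) :
    IsMarkovAdditive (canonicalFiltration (𝓜 × ℝ))
      (fun t (w : CadlagPath (𝓜 × ℝ)) => (w.1 t).1)
      (fun t (w : CadlagPath (𝓜 × ℝ)) => (w.1 t).2)
      (canonicalLaw M σ hM_cadlag hσ_cadlag hσ_mono P) := by
  obtain ⟨ρ, hρp, hρ⟩ : ∃ ρ : ℝ≥0 → Measure ℝ, (∀ t, IsProbabilityMeasure (ρ t)) ∧
      ∀ z t, (P z).map (fun ω => σ t ω - σ 0 ω) = ρ t := by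
    -- The common law is read off at an arbitrary starting point; if there is none, any probability
    -- measure will do.
    rcases isEmpty_or_nonempty 𝓜 with h | ⟨⟨x⟩⟩
    · exact ⟨fun _ => Measure.dirac 0, fun _ => inferInstance, fun z => h.elim z.1⟩
    · exact ⟨fun t => (P (x, 0)).map (fun ω => σ t ω - σ 0 ω),
        fun t => Measure.isProbabilityMeasure_map ((hσ_meas t).sub (hσ_meas 0)).aemeasurable,
        fun z t => HasSubordinatorLaw.map_eq hσ_meas hσ_mono (hσ z) (hσ (x, 0)) t⟩
  have hint : ∀ (t : ℝ≥0) (x : 𝓜) (f : C₀(𝓜, ℝ)),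
      ∫ y, f y ∂((P (x, 0)).map (M t)) = S t f x := fun t x f => by
    exact (integral_map (hM_meas t).aemeasurable
      f.continuous.measurable.aestronglyMeasurable).trans ((hM x 0).integral_eq t f)
  have hpp : ∀ q : ℝ≥0 × 𝓜, IsProbabilityMeasure ((P (q.2, 0)).map (M q.1)) := fun q =>
    Measure.isProbabilityMeasure_map (hM_meas q.1).aemeasurable
  -- Starting `σ` at `0` is an arbitrary choice: by `hint` the integrals of `C₀` functions are given
  -- by the semigroup. The existence of the process provides total mass one.
  let p : Kernel (ℝ≥0 × 𝓜) 𝓜 :=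
    ⟨fun q => (P (q.2, 0)).map (M q.1), measurable_measure_of_integral_zeroAtInfty fun f => by
      simp only [hint]
      exact (hS.continuous_apply f).measurable⟩
  have : IsMarkovKernel p := ⟨hpp⟩
  have hpath := measurable_pairPath hM_meas hσ_meas hM_cadlag hσ_cadlag hσ_mono
  have : ∀ z, IsProbabilityMeasure (canonicalLaw M σ hM_cadlag hσ_cadlag hσ_mono P z) := fun z =>
    Measure.isProbabilityMeasure_map hpath.aemeasurable
  have hev : ∀ t, Measurable fun w : CadlagPath (𝓜 × ℝ) => w.1 t := fun t =>
    (measurable_pi_apply t).comp measurable_subtype_coe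
  refine ⟨fun t => timeChangedKernel p (ρ t), isMarkovAdditiveWith_of_map_past
    (fun z => ?_) fun z s t => ?_⟩
  · refine (ae_map_iff hpath.aemeasurable (hev 0 (measurableSet_singleton z))).2 ?_
    filter_upwards [(hM z.1 z.2).initial, hσ_init z.1 z.2] with ω hω hω'
    change (M (σ 0 ω - σ 0 ω).toNNReal ω, σ 0 ω) = z
    rw [sub_self, Real.toNNReal_zero, hω, hω']
  · have hlaw := map_past_timeChangedPair (μ := P z) (p := p) (ρ := ρ t) hM_meas hM_cadlag
      hσ_meas hσ_cadlag hσ_mono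
      (fun a r => (hM z.1 z.2).map_past_eq a r fun f y => hint r y f) (hMσ z) (s := s) (t := t)
      ((hσ z).indepFun_pathPast hσ_meas (hσ_init z.1 z.2) s t)
      (((hσ z).map_increment_eq s t).trans (hρ z t))
    have hnext : Measurable fun w : CadlagPath (𝓜 × ℝ) =>
        (pathPast s w.1, ((w.1 (s + t)).1, (w.1 (s + t)).2 - (w.1 s).2)) :=
      (measurable_pathPast hev s).prodMk ((hev _).fst.prodMk ((hev _).snd.sub (hev _).snd))
    rw [canonicalLaw, Measure.map_map hnext hpath,
      Measure.map_map (measurable_pathPast hev s) hpath]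
    exact hlaw
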